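/- Notation. A weight sequence is a sequence $w=(w_j)_{j\ge 0}$ of positive reals with $\sup_j w_{j+1}/w_j<\infty$. Let $H^2_w$ be the Hilbert space of power series $f=\sum_{j\ge 0}a_jz^j$ with $\|f\|^2=\sum_{j\ge0}|a_j|^2w_j<\infty$; the backward shift on $H^2_w$ is the adjoint of the bounded operator $f\mapsto zf$. For an integer $n\ge1$ let $\mathcal M_n$ be the space $H^2_w$ with $w_k=1/\binom{n+k-1}{k}$, and let $S_n^*$ be its backward shift. A bounded operator $T$ on a Hilbert space is an $n$-hypercontraction if $\sum_{j=0}^k(-1)^j\binom kj (T^*)^jT^j\ge0$ for all $1\le k\le n$. Two bounded operators $T,T'$ are similar if $XT=T'X$ for some bounded invertible operator $X$. Let $\mathbb D$ be the open unit disk. The operator $T$ on $\mathcal H$ belongs to the Cowen–Douglas class $B_1(\mathbb D)$ if $\mathbb D\subseteq\sigma(T)$, $\operatorname{ran}(T-z)$ is closed and $\dim\ker(T-z)=1$ for every $z\in\mathbb D$, and the spaces $\ker(T-z)$, $z\in\mathbb D$, span a dense subspace of $\mathcal H$; its curvature is then $\mathcal K_T(z)=-\partial\bar\partial\log\|\gamma(z)\|^2$,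 where $\gamma$ is any local nonvanishing holomorphic function with $\gamma(z)\in\ker(T-z)$. **Corollary 1.7.** For every integer $n\ge1$ there is a weight sequence $w$ with $\liminf_j w_j^{1/j}=1$ whose backward shift $T$ on $H^2_w$ belongs to $B_1(\mathbb D)$ and has the following properties. 1. $T$ is not an $n$-hypercontraction. 2. There is a positive, bounded, real-analytic function $\psi$ on $\mathbb D$ such that $$\partial\bar\partial\psi(z)=\mathcal K_{S_n^*}(z)-\mathcal K_T(z)\qquad\text{for every } z\in\mathbb D.$$ 3. $T$ is not similar to $S_n^*$. -/

import Mathlib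

open Filter Topology
open scoped InnerProductSpace

noncomputable section

/-! ### Weighted spaces of power series and their shifts -/

/-- A weight sequence `w₀, w₁, …` of positive reals with `sup_j w_{j+1} / w_j < ∞`
(so that the shift is bounded on the associated space). -/
structure ShiftWeight where
  /-- the weights -/
  w : ℕ → ℝ
  pos : ∀ j, 0 < w j
  bdd : BddAbove (Set.range fun j => w (j + 1) / w j)

namespace ShiftWeight

variable (W : ShiftWeight)

theorem norm_scale_sq (j : ℕ) (a : ℂ) :
    ‖((√(W.w j) : ℝ) : ℂ) * a‖ ^ 2 = W.w j * ‖a‖ ^ 2 := by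
  rw [norm_mul, Complex.norm_real, mul_pow, Real.norm_eq_abs, sq_abs, Real.sq_sqrt (W.pos j).le]

theorem memlp_scale_iff (a : ℕ → ℂ) :
    Memℓp (fun j => ((√(W.w j) : ℝ) : ℂ) * a j) 2 ↔ Summable fun j => W.w j * ‖a j‖ ^ 2 := by
  rw [memℓp_gen_iff (by norm_num)]
  refine summable_congr fun j => ?_
  rw [← W.norm_scale_sq]
  simp

/-- The space `H²_w` of the power series `f = ∑ a_j z^j` with `∑ |a_j|² w_j < ∞`. -/
def H2 : Submodule ℂ (PowerSeries ℂ) where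
  carrier := {f | Summable fun j => W.w j * ‖PowerSeries.coeff j f‖ ^ 2}
  zero_mem' := by simp [summable_zero]
  add_mem' := by
    intro f g hf hg
    have hf' := (W.memlp_scale_iff _).2 hf
    have hg' := (W.memlp_scale_iff _).2 hg
    refine (W.memlp_scale_iff _).1 ?_
    convert hf'.add hg' using 1
    funext j
    simp [mul_add]
  smul_mem' := by
    intro c f hf
    have hf' := (W.memlp_scale_iff _).2 hf
    refine (W.memlp_scale_iff _).1 ?_
    convert hf'.const_smul c using 1
    funext j
    simp [mul_left_comm]

/-- The linear identification of `H²_w` with `ℓ²`, given by `a_j ↦ √w_j a_j`. -/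
def toEll2 : W.H2 ≃ₗ[ℂ] lp (fun _ : ℕ => ℂ) 2 where
  toFun f := ⟨fun j => ((√(W.w j) : ℝ) : ℂ) * PowerSeries.coeff j f.1,
    (W.memlp_scale_iff _).2 f.2⟩
  map_add' f g := by
    ext j
    simp only [Submodule.coe_add, map_add, mul_add]
    rfl
  map_smul' c f := by
    ext j
    simp [mul_left_comm]
  invFun b := ⟨PowerSeries.mk fun j => ((√(W.w j) : ℝ) : ℂ)⁻¹ * b j, by
    refine (W.memlp_scale_iff _).1 ?_
    convert lp.memℓp b using 1
    funext j
    have : ((√(W.w j) : ℝ) : ℂ) ≠ 0 := by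
      exact_mod_cast (Real.sqrt_pos.2 (W.pos j)).ne'
    simp [mul_inv_cancel_left₀ this]⟩
  left_inv f := by
    ext j
    have : ((√(W.w j) : ℝ) : ℂ) ≠ 0 := by
      exact_mod_cast (Real.sqrt_pos.2 (W.pos j)).ne'
    simp [inv_mul_cancel_left₀ this]
  right_inv b := by
    ext j
    have : ((√(W.w j) : ℝ) : ℂ) ≠ 0 := by
      exact_mod_cast (Real.sqrt_pos.2 (W.pos j)).ne'
    simp [mul_inv_cancel_left₀ this]

/-- The inner product `⟨f, g⟩ = ∑ w_j conj(a_j) b_j` of `H²_w` (conjugate-linear in the first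
variable). -/
def innerH2 (f g : W.H2) : ℂ :=
  ∑' j, (W.w j : ℂ) * (starRingEnd ℂ (PowerSeries.coeff j f.1) * PowerSeries.coeff j g.1)

theorem inner_toEll2 (f g : W.H2) : ⟪W.toEll2 f, W.toEll2 g⟫_ℂ = W.innerH2 f g := by
  rw [lp.inner_eq_tsum]
  refine tsum_congr fun j => ?_
  have h : ((√(W.w j) : ℝ) : ℂ) * ((√(W.w j) : ℝ) : ℂ) = (W.w j : ℂ) := by
    exact_mod_cast Real.mul_self_sqrt (W.pos j).le
  simp only [toEll2, LinearEquiv.coe_mk, LinearMap.coe_mk, AddHom.coe_mk, RCLike.inner_apply,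
    map_mul, Complex.conj_ofReal]
  rw [← h]
  ring

/-- The inner product space axioms for `H²_w`. -/
abbrev innerCore : InnerProductSpace.Core ℂ W.H2 where
  inner f g := W.innerH2 f g
  conj_inner_symm f g := by
    rw [← W.inner_toEll2, ← W.inner_toEll2, inner_conj_symm]
  re_inner_nonneg f := by
    rw [← W.inner_toEll2]
    exact inner_self_nonneg
  add_left f g h := by
    simp only [← W.inner_toEll2, map_add, inner_add_left]
  smul_left f g c := by
    simp only [← W.inner_toEll2, map_smul, inner_smul_left]
  definite f hf := by
    rw [← W.inner_toEll2, inner_self_eq_zero] at hf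
    exact W.toEll2.map_eq_zero_iff.1 hf

instance : NormedAddCommGroup W.H2 := W.innerCore.toNormedAddCommGroup

instance : InnerProductSpace ℂ W.H2 := InnerProductSpace.ofCore W.innerCore.toCore

theorem norm_toEll2 (f : W.H2) : ‖W.toEll2 f‖ = ‖f‖ := by
  rw [@norm_eq_sqrt_re_inner ℂ, @norm_eq_sqrt_re_inner ℂ, W.inner_toEll2]
  rfl

instance : CompleteSpace W.H2 :=
  (LinearIsometryEquiv.mk W.toEll2 W.norm_toEll2).toIsometryEquiv.completeSpace

theorem norm_sq_eq (f : W.H2) : ‖f‖ ^ 2 = ∑' j, W.w j * ‖PowerSeries.coeff j f.1‖ ^ 2 := by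
  have h := lp.norm_rpow_eq_tsum (p := 2) (by norm_num) (W.toEll2 f)
  rw [W.norm_toEll2] at h
  simp only [ENNReal.toReal_ofNat, Real.rpow_ofNat] at h
  rw [h]
  exact tsum_congr fun j => W.norm_scale_sq j _

theorem exists_ratio_bound : ∃ C : ℝ, 0 ≤ C ∧ ∀ j, W.w (j + 1) ≤ C * W.w j := by
  obtain ⟨C, hC⟩ := W.bdd
  have hC' : ∀ j, W.w (j + 1) ≤ C * W.w j := fun j =>
    (div_le_iff₀ (W.pos j)).1 (hC ⟨j, rfl⟩)
  refine ⟨C, ?_, hC'⟩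
  by_contra h
  have h1 := hC' 0
  have h2 := W.pos 0
  have h3 := W.pos 1
  simp only [zero_add] at h1
  nlinarith

theorem X_mul_term_le {C : ℝ} (hC : ∀ j, W.w (j + 1) ≤ C * W.w j) (f : PowerSeries ℂ) (j : ℕ) :
    W.w (j + 1) * ‖PowerSeries.coeff (j + 1) (PowerSeries.X * f)‖ ^ 2
      ≤ C * (W.w j * ‖PowerSeries.coeff j f‖ ^ 2) := by
  rw [PowerSeries.coeff_succ_X_mul, ← mul_assoc]
  exact mul_le_mul_of_nonneg_right (hC j) (by positivity)

theorem X_mul_mem (f : W.H2) : PowerSeries.X * f.1 ∈ W.H2 := by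
  obtain ⟨C, -, hC⟩ := W.exists_ratio_bound
  have hf : Summable fun j => W.w j * ‖PowerSeries.coeff j f.1‖ ^ 2 := f.2
  refine (summable_nat_add_iff 1).1 ?_
  exact Summable.of_nonneg_of_le (fun j => mul_nonneg (W.pos _).le (by positivity))
    (W.X_mul_term_le hC f.1) (hf.mul_left C)

/-- The (forward) shift `S f = z f` on `H²_w`, as a linear map. -/
def shiftLin : W.H2 →ₗ[ℂ] W.H2 where
  toFun f := ⟨PowerSeries.X * f.1, W.X_mul_mem f⟩
  map_add' f g := by
    ext1
    simp [mul_add]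
  map_smul' c f := by
    ext1
    simp

theorem exists_shiftLin_bound : ∃ C : ℝ, ∀ f, ‖W.shiftLin f‖ ≤ C * ‖f‖ := by
  obtain ⟨C, hC0, hC⟩ := W.exists_ratio_bound
  refine ⟨√C, fun f => ?_⟩
  have hf : Summable fun j => W.w j * ‖PowerSeries.coeff j f.1‖ ^ 2 := f.2
  have hg : Summable fun j => W.w j * ‖PowerSeries.coeff j (PowerSeries.X * f.1)‖ ^ 2 :=
    W.X_mul_mem f
  refine le_of_sq_le_sq ?_ (by positivity)
  rw [mul_pow, Real.sq_sqrt hC0, W.norm_sq_eq, W.norm_sq_eq, ← tsum_mul_left]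
  change ∑' j, W.w j * ‖PowerSeries.coeff j (PowerSeries.X * f.1)‖ ^ 2 ≤ _
  rw [hg.tsum_eq_zero_add]
  simp only [PowerSeries.coeff_zero_X_mul, norm_zero, ne_eq, OfNat.ofNat_ne_zero,
    not_false_eq_true, zero_pow, mul_zero, zero_add]
  exact ((summable_nat_add_iff 1).2 hg).tsum_le_tsum (W.X_mul_term_le hC f.1) (hf.mul_left C)

/-- The (forward) shift `S f = z f` on `H²_w`, a bounded operator. -/
def shift : W.H2 →L[ℂ] W.H2 :=
  W.shiftLin.mkContinuousOfExistsBound W.exists_shiftLin_bound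

/-- The backward shift on `H²_w`: the adjoint of the forward shift `f ↦ z f`. -/
def backwardShift : W.H2 →L[ℂ] W.H2 :=
  ContinuousLinearMap.adjoint W.shift

/-- The weights `1 / C(n+k-1, k)` of the space `M_n` (`n ≥ 1`), i.e. of the Hardy space (`n = 1`)
and of the weighted Bergman spaces (`n ≥ 2`). -/
def bergman (n : ℕ) (hn : 1 ≤ n) : ShiftWeight where
  w k := 1 / ((n + k - 1).choose k : ℝ)
  pos k := by
    have : 0 < (n + k - 1).choose k := Nat.choose_pos (by omega)
    positivity
  bdd := by
    refine ⟨1, ?_⟩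
    rintro _ ⟨k, rfl⟩
    have h0 : 0 < (n + k - 1).choose k := Nat.choose_pos (by omega)
    have h1 : 0 < (n + (k + 1) - 1).choose (k + 1) := Nat.choose_pos (by omega)
    have h2 : (n + k - 1).choose k ≤ (n + (k + 1) - 1).choose (k + 1) := by
      have : n + (k + 1) - 1 = (n + k - 1) + 1 := by omega
      rw [this, Nat.choose_succ_succ]
      omega
    have h3 : ((n + k - 1).choose k : ℝ) ≤ ((n + (k + 1) - 1).choose (k + 1) : ℝ) := by
      exact_mod_cast h2
    have h0' : (0 : ℝ) < (n + k - 1).choose k := by exact_mod_cast h0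
    have h1' : (0 : ℝ) < (n + (k + 1) - 1).choose (k + 1) := by exact_mod_cast h1
    rw [div_le_one (by positivity)]
    exact one_div_le_one_div_of_le h0' h3

end ShiftWeight

/-! ### Classes of operators and similarity -/

section Operators

variable {H : Type*} [NormedAddCommGroup H] [InnerProductSpace ℂ H]

/-- `T` is an `n`-hypercontraction: `∑_{j=0}^k (-1)^j C(k,j) (T*)^j T^j ≥ 0` for all
`1 ≤ k ≤ n`. -/
def IsHypercontraction [CompleteSpace H] (n : ℕ) (T : H →L[ℂ] H) : Prop :=
  ∀ k : ℕ, 1 ≤ k → k ≤ n →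
    (∑ j ∈ Finset.range (k + 1),
      ((-1 : ℂ) ^ j * (k.choose j : ℂ)) •
        (ContinuousLinearMap.adjoint T ^ j * T ^ j)).IsPositive

/-- The Cowen-Douglas class `B_m(Ω)`, for a positive integer `m` and an open connected set
`Ω ⊆ ℂ`. -/
structure IsCowenDouglas (m : ℕ) (Ω : Set ℂ) (T : H →L[ℂ] H) : Prop where
  rank_pos : 0 < m
  isOpen : IsOpen Ω
  isConnected : IsConnected Ω
  subset_spectrum : Ω ⊆ spectrum ℂ T
  isClosed_range : ∀ z ∈ Ω, IsClosed (Set.range (T - z • ContinuousLinearMap.id ℂ H))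
  span_ker : (⨆ z ∈ Ω, (T - z • ContinuousLinearMap.id ℂ H).ker).topologicalClosure = ⊤
  finrank_ker : ∀ z ∈ Ω, Module.finrank ℂ (T - z • ContinuousLinearMap.id ℂ H).ker = m

/-- Two bounded operators are similar if they are intertwined by a bounded invertible operator. -/
def AreSimilar {H' : Type*} [NormedAddCommGroup H'] [InnerProductSpace ℂ H']
    (T : H →L[ℂ] H) (T' : H' →L[ℂ] H') : Prop :=
  ∃ X : H ≃L[ℂ] H', ∀ x, X (T x) = T' (X x)

end Operators

/-! ### Curvature -/

/-- The Wirtinger derivative `∂ = (∂/∂x - i ∂/∂y) / 2`. -/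
def wirtinger (f : ℂ → ℂ) (z : ℂ) : ℂ :=
  (fderiv ℝ f z 1 - Complex.I * fderiv ℝ f z Complex.I) / 2

/-- The Wirtinger derivative `∂̄ = (∂/∂x + i ∂/∂y) / 2`. -/
def wirtingerBar (f : ℂ → ℂ) (z : ℂ) : ℂ :=
  (fderiv ℝ f z 1 + Complex.I * fderiv ℝ f z Complex.I) / 2

/-- `∂∂̄ u` for a real-valued function `u` of a complex variable. -/
def ddbar (u : ℂ → ℝ) : ℂ → ℂ :=
  wirtinger (wirtingerBar fun z => (u z : ℂ))

section Curvature

variable {H : Type*} [NormedAddCommGroup H] [InnerProductSpace ℂ H]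

/-- `γ` is a holomorphic frame near `z₀` of the eigenvector bundle
`{(z, x) : x ∈ ker (T - z)}` of an operator `T` whose eigenspaces are lines: a holomorphic
section that does not vanish at `z₀`. -/
structure IsEigenFrameAt (T : H →L[ℂ] H) (z₀ : ℂ) (γ : ℂ → H) : Prop where
  analyticAt : AnalyticAt ℂ γ z₀
  ne_zero : γ z₀ ≠ 0
  eigen : ∀ᶠ z in 𝓝 z₀, T (γ z) = z • γ z

open Classical in
/-- The curvature `K_T(z₀) = -∂∂̄ log ‖γ‖²` at `z₀` of the eigenvector bundle of an operator `T` in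
`B_1(Ω)`, where `z₀ ∈ Ω` and `γ` is a holomorphic frame near `z₀`. The value does not depend on the
frame, since two frames differ by a nonvanishing holomorphic factor. (It is `0` by convention if
there is no frame, which does not happen for operators in `B_1(Ω)`.) -/
def curvature (T : H →L[ℂ] H) (z₀ : ℂ) : ℂ :=
  if h : ∃ γ : ℂ → H, IsEigenFrameAt T z₀ γ then
    -ddbar (fun z => Real.log (‖h.choose z‖ ^ 2)) z₀
  else 0

end Curvature

end

/-! Write n = m + 1. The weights of M_n are 1/C(j+m, m), and those of T are 1/(C(j+m, m)(1 + b_j)),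
where b_j ≥ 0 is unbounded, changes by at most 1 per step, and satisfies ∑ b_j/(j+1) < ∞. Such b
comes from triangular bumps of height k placed near 4^k.

The eigenvector of a backward shift at z is ∑ z^j X^j / w_j, with squared norm ∑ |z|^(2j)/w_j. With
r = |z|², this equals (1-r)^(-n) for M_n and (1-r)^(-n) + ∑ b_j C(j+m, m) r^j for T. Since C(j+m, m)
r^j ≤ 2^n (1-r)^(-n)/(j+1) (`choose_mul_pow_le`), the ratio of the two norms lies between 1 and a
constant. Its logarithm is bounded, and ∂∂̄ of it is the difference of the curvatures.

Similarity would force the weights to be comparable (`exists_weight_le_of_intertwine`), hence b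
bounded. A contraction would have nonincreasing weights; a large b_j would then persist on all of
[j, 2j], against ∑ b_j/(j+1) < ∞. The slow variation of b gives the shift a left inverse with
polynomially bounded powers, from which T - z is onto for |z| < 1. -/

noncomputable section

/-! ### Monomials, coefficients and intertwiners -/

namespace ShiftWeight

variable (W : ShiftWeight)

theorem inner_eq_tsum (f g : W.H2) : ⟪f, g⟫_ℂ =
    ∑' j, (W.w j : ℂ) * (starRingEnd ℂ (PowerSeries.coeff j f.1) * PowerSeries.coeff j g.1) :=
  rfl

/-- The monomial `z ^ j` as an element of `H²_w`. -/
def mono (j : ℕ) : W.H2 :=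
  ⟨PowerSeries.X ^ j, by
    refine summable_of_ne_finset_zero (s := {j}) fun i hi => ?_
    have : i ≠ j := by simpa using hi
    simp [PowerSeries.coeff_X_pow, this]⟩

theorem coeff_mono (i j : ℕ) :
    PowerSeries.coeff i (W.mono j).1 = if i = j then 1 else 0 :=
  PowerSeries.coeff_X_pow i j

theorem inner_mono_left (j : ℕ) (f : W.H2) :
    ⟪W.mono j, f⟫_ℂ = W.w j * PowerSeries.coeff j f.1 := by
  rw [inner_eq_tsum, tsum_eq_single j]
  · simp [coeff_mono]
  · intro i hi
    simp [coeff_mono, hi]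

theorem norm_mono_sq (j : ℕ) : ‖W.mono j‖ ^ 2 = W.w j := by
  rw [norm_sq_eq, tsum_eq_single j]
  · simp [coeff_mono]
  · intro i hi
    simp [coeff_mono, hi]

/-- The `j`-th coefficient as a bounded functional on `H²_w`. -/
def coeffCLM (j : ℕ) : W.H2 →L[ℂ] ℂ :=
  (W.w j : ℂ)⁻¹ • innerSL ℂ (W.mono j)

theorem coeffCLM_apply (j : ℕ) (f : W.H2) : W.coeffCLM j f = PowerSeries.coeff j f.1 := by
  have : (W.w j : ℂ) ≠ 0 := by exact_mod_cast (W.pos j).ne'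
  simp [coeffCLM, inner_mono_left, this]

theorem ext_coeff {f g : W.H2}
    (h : ∀ j, PowerSeries.coeff j f.1 = PowerSeries.coeff j g.1) : f = g :=
  Subtype.ext (PowerSeries.ext h)

theorem shift_mono (j : ℕ) : W.shift (W.mono j) = W.mono (j + 1) :=
  Subtype.ext (pow_succ' _ _).symm

theorem coeff_backwardShift (f : W.H2) (j : ℕ) :
    PowerSeries.coeff j (W.backwardShift f).1
      = (W.w (j + 1) : ℂ) / W.w j * PowerSeries.coeff (j + 1) f.1 := by
  have hj : (W.w j : ℂ) ≠ 0 := by exact_mod_cast (W.pos j).ne'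
  have h := W.inner_mono_left j (W.backwardShift f)
  rw [backwardShift, ContinuousLinearMap.adjoint_inner_right, shift_mono, inner_mono_left] at h
  rw [div_mul_eq_mul_div, eq_div_iff hj, h]
  simp [backwardShift, mul_comm]

theorem weight_mul_sq_le (f : W.H2) (j : ℕ) :
    W.w j * ‖PowerSeries.coeff j f.1‖ ^ 2 ≤ ‖f‖ ^ 2 := by
  rw [norm_sq_eq]
  have hf : Summable fun j => W.w j * ‖PowerSeries.coeff j f.1‖ ^ 2 := f.2
  exact hf.le_tsum j fun i _ => mul_nonneg (W.pos i).le (by positivity)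

theorem backwardShift_mono_succ (j : ℕ) :
    W.backwardShift (W.mono (j + 1)) = ((W.w (j + 1) : ℂ) / W.w j) • W.mono j := by
  refine W.ext_coeff fun i => ?_
  rw [coeff_backwardShift, coeff_mono]
  change _ = PowerSeries.coeff i (((W.w (j + 1) : ℂ) / W.w j) • (W.mono j).1)
  rw [map_smul, coeff_mono, smul_eq_mul]
  by_cases h : i = j
  · simp [h]
  · simp [h]

theorem backwardShift_mono_zero : W.backwardShift (W.mono 0) = 0 := by
  refine W.ext_coeff fun i => ?_
  rw [coeff_backwardShift, coeff_mono]
  simp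

theorem coeff_zero_backwardShift_pow (k : ℕ) (f : W.H2) :
    PowerSeries.coeff 0 ((W.backwardShift ^ k) f).1
      = (W.w k : ℂ) / W.w 0 * PowerSeries.coeff k f.1 := by
  induction k generalizing f with
  | zero =>
    have : (W.w 0 : ℂ) ≠ 0 := by exact_mod_cast (W.pos 0).ne'
    simp [this]
  | succ k ih =>
    have : (W.w k : ℂ) ≠ 0 := by exact_mod_cast (W.pos k).ne'
    rw [pow_succ, mul_apply_eq_comp, ih, coeff_backwardShift]
    field_simp

theorem backwardShift_pow_mono (k : ℕ) :
    (W.backwardShift ^ k) (W.mono k) = ((W.w k : ℂ) / W.w 0) • W.mono 0 := by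
  induction k with
  | zero =>
    have : (W.w 0 : ℂ) ≠ 0 := by exact_mod_cast (W.pos 0).ne'
    simp [this]
  | succ k ih =>
    have : (W.w k : ℂ) ≠ 0 := by exact_mod_cast (W.pos k).ne'
    rw [pow_succ, mul_apply_eq_comp, backwardShift_mono_succ, map_smul, ih, smul_smul]
    congr 1
    field_simp

/-- Eigenvectors of the backward shift are determined by their constant coefficient. -/
theorem coeff_of_eigen {f : W.H2} {z : ℂ} (h : W.backwardShift f = z • f) (j : ℕ) :
    (W.w j : ℂ) * PowerSeries.coeff j f.1 = z ^ j * (W.w 0 * PowerSeries.coeff 0 f.1) := by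
  induction j with
  | zero => simp
  | succ j ih =>
    have hj : (W.w j : ℂ) ≠ 0 := by exact_mod_cast (W.pos j).ne'
    have h1 := W.coeff_backwardShift f j
    rw [h] at h1
    change PowerSeries.coeff j (z • f.1) = _ at h1
    rw [map_smul, smul_eq_mul, div_mul_eq_mul_div, eq_div_iff hj] at h1
    linear_combination z * ih - h1

/-- An intertwiner of backward shifts that does not kill constants controls the weights. -/
theorem exists_weight_le_of_intertwine {V : ShiftWeight} (X : V.H2 →L[ℂ] W.H2)
    (hX : Function.Injective X) (h : ∀ x, X (V.backwardShift x) = W.backwardShift (X x)) :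
    ∃ C : ℝ, ∀ k, V.w k ≤ C * W.w k := by
  have hpow : ∀ k x, X ((V.backwardShift ^ k) x) = (W.backwardShift ^ k) (X x) := by
    intro k
    induction k with
    | zero => simp
    | succ k ih =>
      intro x
      rw [pow_succ, mul_apply_eq_comp, ih, h, pow_succ, mul_apply_eq_comp]
  set x₀ : ℂ := PowerSeries.coeff 0 (X (V.mono 0)).1 with hx₀
  -- X sends the constant 1 into the kernel of the second backward shift, where only constants live.
  have hx₀ne : x₀ ≠ 0 := by
    intro h0
    have he : W.backwardShift (X (V.mono 0)) = (0 : ℂ) • X (V.mono 0) := by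
      rw [← h, backwardShift_mono_zero, map_zero, zero_smul]
    have hz : X (V.mono 0) = 0 := by
      refine W.ext_coeff fun j => ?_
      have h1 := W.coeff_of_eigen he j
      rw [← hx₀, h0, mul_zero, mul_zero] at h1
      have hj : (W.w j : ℂ) ≠ 0 := by exact_mod_cast (W.pos j).ne'
      simpa [hj] using h1
    have h2 : V.mono 0 = 0 := hX (by rw [hz, map_zero])
    have h3 := V.norm_mono_sq 0
    rw [h2, norm_zero] at h3
    have := V.pos 0
    norm_num at h3
    linarith
  have hx₀pos : 0 < ‖x₀‖ := norm_pos_iff.2 hx₀ne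
  have hV0 := V.pos 0
  have hW0 := W.pos 0
  -- Apply X to the k-th power of the backward shift on z^k and compare constant coefficients:
  -- (V_k/V_0) x₀ = (W_k/W_0) c_k. Here c_k is the k-th coefficient of X z^k, so W_k |c_k|² ≤ ‖X‖²
  -- V_k. Squaring and eliminating c_k gives this constant.
  refine ⟨‖X‖ ^ 2 * V.w 0 ^ 2 / (W.w 0 ^ 2 * ‖x₀‖ ^ 2), fun k => ?_⟩
  have hVk := V.pos k
  have hWk := W.pos k
  have h1 := W.coeff_zero_backwardShift_pow k (X (V.mono k))
  rw [← hpow, backwardShift_pow_mono, map_smul] at h1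
  change PowerSeries.coeff 0 (((V.w k : ℂ) / V.w 0) • (X (V.mono 0)).1) = _ at h1
  rw [map_smul, smul_eq_mul, ← hx₀] at h1
  have h2 := congrArg norm h1
  simp only [norm_mul, norm_div, Complex.norm_real, Real.norm_eq_abs, abs_of_pos hVk,
    abs_of_pos hWk, abs_of_pos hV0, abs_of_pos hW0] at h2
  set c := ‖PowerSeries.coeff k (X (V.mono k)).1‖
  have h3 : W.w k * c ^ 2 ≤ ‖X‖ ^ 2 * V.w k := by
    refine (W.weight_mul_sq_le (X (V.mono k)) k).trans ?_
    rw [← V.norm_mono_sq k, ← mul_pow]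
    exact pow_le_pow_left₀ (norm_nonneg _) (X.le_opNorm _) 2
  have h4 : V.w k * ‖x₀‖ * W.w 0 = W.w k * c * V.w 0 := by
    field_simp at h2
    linarith
  rw [div_mul_eq_mul_div, le_div_iff₀ (by positivity)]
  refine le_of_mul_le_mul_left ?_ hVk
  calc V.w k * (V.w k * (W.w 0 ^ 2 * ‖x₀‖ ^ 2)) = (V.w k * ‖x₀‖ * W.w 0) ^ 2 := by ring
    _ = (W.w k * V.w 0 ^ 2) * (W.w k * c ^ 2) := by rw [h4]; ring
    _ ≤ (W.w k * V.w 0 ^ 2) * (‖X‖ ^ 2 * V.w k) := by gcongr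
    _ = _ := by ring

/-- A backward shift that is a contraction has nonincreasing weights. -/
theorem weight_succ_le_of_contraction (h : IsHypercontraction 1 W.backwardShift) (j : ℕ) :
    W.w (j + 1) ≤ W.w j := by
  -- Positivity of 1 - T*T tested at z^(j+1) reads w_(j+1)²/w_j ≤ w_(j+1).
  have h1 := (h 1 le_rfl le_rfl).re_inner_nonneg_right (W.mono (j + 1))
  rw [Finset.sum_range_succ, Finset.sum_range_one] at h1
  simp only [pow_zero, pow_one, Nat.choose_self, Nat.cast_one, mul_one, one_smul, neg_smul,
    add_apply, neg_apply, mul_apply_eq_comp,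
    one_apply_eq_self, inner_add_right, inner_neg_right,
    ContinuousLinearMap.adjoint_inner_right, map_add, map_neg, Nat.choose_zero_right,
    inner_self_eq_norm_sq, backwardShift_mono_succ, norm_smul, mul_pow, norm_mono_sq, norm_div,
    Complex.norm_real, Real.norm_eq_abs, sq_abs, div_pow] at h1
  have hj := W.pos j
  have hj1 := W.pos (j + 1)
  have h2 : W.w (j + 1) ^ 2 / W.w j ^ 2 * W.w j = W.w (j + 1) * (W.w (j + 1) / W.w j) := by
    field_simp
  rw [h2] at h1
  have h3 : W.w (j + 1) / W.w j ≤ 1 := by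
    by_contra hc
    push Not at hc
    nlinarith
  exact (div_le_one hj).1 h3

/-! ### The holomorphic family of eigenvectors -/

/-- The reproducing kernels of `H²_w` are defined on the unit disk. -/
def KernelSummable : Prop :=
  ∀ r : ℝ, 0 ≤ r → r < 1 → Summable fun j => r ^ j / W.w j

/-- The power series `∑ z^j X^j / w_j` of the eigenvectors of the backward shift. -/
def eigenSeries : FormalMultilinearSeries ℂ ℂ W.H2 := fun j =>
  ContinuousMultilinearMap.mkPiRing ℂ (Fin j) ((W.w j : ℂ)⁻¹ • W.mono j)

/-- The canonical eigenvector `∑ z^j X^j / w_j` of the backward shift. -/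
def eigenvec (z : ℂ) : W.H2 := W.eigenSeries.sum z

variable {W}

/-- The j-th coefficient has squared norm 1/w_j, so the squares of the terms at radius r are
r^(2j)/w_j. These are the terms of a convergent series, hence bounded. -/
theorem KernelSummable.one_le_radius (hW : W.KernelSummable) : 1 ≤ W.eigenSeries.radius := by
  refine ENNReal.le_of_forall_nnreal_lt fun r hr => ?_
  have hr1 : (r : ℝ) < 1 := by exact_mod_cast hr
  have hs := hW ((r : ℝ) ^ 2) (by positivity) (by nlinarith [r.coe_nonneg])
  obtain ⟨C, hC⟩ := hs.tendsto_atTop_zero.bddAbove_range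
  refine W.eigenSeries.le_radius_of_bound √C fun j => ?_
  refine Real.le_sqrt_of_sq_le ?_
  have hj := W.pos j
  refine le_trans (le_of_eq ?_) (hC ⟨j, rfl⟩)
  rw [eigenSeries, ContinuousMultilinearMap.norm_mkPiRing, mul_pow, norm_smul, mul_pow,
    norm_mono_sq, norm_inv, Complex.norm_real, Real.norm_eq_abs, inv_pow, sq_abs]
  field_simp
  ring

theorem KernelSummable.hasFPowerSeriesOnBall (hW : W.KernelSummable) :
    HasFPowerSeriesOnBall W.eigenvec W.eigenSeries 0 W.eigenSeries.radius :=
  W.eigenSeries.hasFPowerSeriesOnBall (zero_lt_one.trans_le hW.one_le_radius)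

theorem mem_eball_radius (hW : W.KernelSummable) {z : ℂ} (hz : z ∈ Metric.ball (0 : ℂ) 1) :
    z ∈ Metric.eball (0 : ℂ) W.eigenSeries.radius := by
  refine Metric.eball_subset_eball hW.one_le_radius ?_
  rw [← ENNReal.ofReal_one, Metric.eball_ofReal]
  exact hz

theorem analyticAt_eigenvec (hW : W.KernelSummable) {z : ℂ} (hz : z ∈ Metric.ball (0 : ℂ) 1) :
    AnalyticAt ℂ W.eigenvec z :=
  hW.hasFPowerSeriesOnBall.analyticAt_of_mem (mem_eball_radius hW hz)

theorem coeff_eigenvec (hW : W.KernelSummable) {z : ℂ} (hz : z ∈ Metric.ball (0 : ℂ) 1) (j : ℕ) :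
    PowerSeries.coeff j (W.eigenvec z).1 = z ^ j / W.w j := by
  have h := (hW.hasFPowerSeriesOnBall.hasSum (mem_eball_radius hW hz)).mapL (W.coeffCLM j)
  rw [zero_add, coeffCLM_apply] at h
  refine h.unique ?_
  convert hasSum_single j ?_ using 1
  · rw [coeffCLM_apply]
    simp [eigenSeries, coeff_mono, div_eq_mul_inv]
  · intro i hi
    rw [coeffCLM_apply]
    simp [eigenSeries, coeff_mono, hi.symm]

theorem backwardShift_eigenvec (hW : W.KernelSummable) {z : ℂ} (hz : z ∈ Metric.ball (0 : ℂ) 1) :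
    W.backwardShift (W.eigenvec z) = z • W.eigenvec z := by
  refine W.ext_coeff fun j => ?_
  have hj : (W.w j : ℂ) ≠ 0 := by exact_mod_cast (W.pos j).ne'
  have hj1 : (W.w (j + 1) : ℂ) ≠ 0 := by exact_mod_cast (W.pos (j + 1)).ne'
  rw [coeff_backwardShift, coeff_eigenvec hW hz]
  change _ = PowerSeries.coeff j (z • (W.eigenvec z).1)
  rw [map_smul, coeff_eigenvec hW hz, smul_eq_mul]
  field_simp
  ring

theorem eigenvec_ne_zero (hW : W.KernelSummable) {z : ℂ} (hz : z ∈ Metric.ball (0 : ℂ) 1) :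
    W.eigenvec z ≠ 0 := by
  intro h
  have h1 := coeff_eigenvec hW hz 0
  have h0 : (W.w 0 : ℂ) ≠ 0 := by exact_mod_cast (W.pos 0).ne'
  rw [h] at h1
  simp at h1
  exact h0 (by exact_mod_cast h1.symm)

theorem eq_smul_eigenvec (hW : W.KernelSummable) {z : ℂ} (hz : z ∈ Metric.ball (0 : ℂ) 1)
    {f : W.H2} (h : W.backwardShift f = z • f) :
    f = (W.w 0 * W.coeffCLM 0 f) • W.eigenvec z := by
  refine W.ext_coeff fun j => ?_
  have hj : (W.w j : ℂ) ≠ 0 := by exact_mod_cast (W.pos j).ne'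
  change _ = PowerSeries.coeff j (((W.w 0 : ℂ) * W.coeffCLM 0 f) • (W.eigenvec z).1)
  rw [map_smul, coeff_eigenvec hW hz, smul_eq_mul, coeffCLM_apply]
  have := W.coeff_of_eigen h j
  field_simp
  linear_combination this

theorem norm_eigenvec_sq (hW : W.KernelSummable) {z : ℂ} (hz : z ∈ Metric.ball (0 : ℂ) 1) :
    ‖W.eigenvec z‖ ^ 2 = ∑' j, (‖z‖ ^ 2) ^ j / W.w j := by
  rw [norm_sq_eq]
  refine tsum_congr fun j => ?_
  have hj := W.pos j
  rw [coeff_eigenvec hW hz, norm_div, norm_pow, Complex.norm_real, Real.norm_eq_abs, div_pow,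
    sq_abs]
  field_simp
  ring

end ShiftWeight

/-! ### Wirtinger calculus -/

theorem wirtingerBar_congr {f g : ℂ → ℂ} {z : ℂ} (h : f =ᶠ[𝓝 z] g) :
    wirtingerBar f z = wirtingerBar g z := by
  rw [wirtingerBar, wirtingerBar, h.fderiv_eq]

theorem wirtinger_congr {f g : ℂ → ℂ} {z : ℂ} (h : f =ᶠ[𝓝 z] g) :
    wirtinger f z = wirtinger g z := by
  rw [wirtinger, wirtinger, h.fderiv_eq]

theorem ddbar_congr {u v : ℂ → ℝ} {z : ℂ} (h : u =ᶠ[𝓝 z] v) : ddbar u z = ddbar v z := by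
  refine wirtinger_congr ?_
  filter_upwards [h.eventually_nhds] with x hx
  exact wirtingerBar_congr (hx.mono fun y hy => by simp [hy])

theorem wirtinger_add {f g : ℂ → ℂ} {z : ℂ} (hf : DifferentiableAt ℝ f z)
    (hg : DifferentiableAt ℝ g z) :
    wirtinger (fun x => f x + g x) z = wirtinger f z + wirtinger g z := by
  simp only [wirtinger, fderiv_fun_add hf hg, add_apply]
  ring

theorem wirtingerBar_add {f g : ℂ → ℂ} {z : ℂ} (hf : DifferentiableAt ℝ f z)
    (hg : DifferentiableAt ℝ g z) :
    wirtingerBar (fun x => f x + g x) z = wirtingerBar f z + wirtingerBar g z := by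
  simp only [wirtingerBar, fderiv_fun_add hf hg, add_apply]
  ring

theorem wirtinger_neg (f : ℂ → ℂ) (z : ℂ) : wirtinger (fun x => -f x) z = -wirtinger f z := by
  simp only [wirtinger, fderiv_fun_neg, neg_apply]
  ring

theorem wirtingerBar_neg (f : ℂ → ℂ) (z : ℂ) :
    wirtingerBar (fun x => -f x) z = -wirtingerBar f z := by
  simp only [wirtingerBar, fderiv_fun_neg, neg_apply]
  ring

theorem analyticAt_ofReal_comp {u : ℂ → ℝ} {z : ℂ} (hu : AnalyticAt ℝ u z) :
    AnalyticAt ℝ (fun x => (u x : ℂ)) z :=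
  (Complex.ofRealCLM.analyticAt _).comp hu

theorem AnalyticAt.wirtingerBar {f : ℂ → ℂ} {z : ℂ} (hf : AnalyticAt ℝ f z) :
    AnalyticAt ℝ (wirtingerBar f) z := by
  have h (v : ℂ) : AnalyticAt ℝ (fun x => fderiv ℝ f x v) z :=
    ((ContinuousLinearMap.apply ℝ ℂ v).analyticAt _).comp hf.fderiv
  exact ((h 1).add (analyticAt_const.mul (h Complex.I))).div_const

theorem ddbar_add {u v : ℂ → ℝ} {z : ℂ} (hu : AnalyticAt ℝ u z) (hv : AnalyticAt ℝ v z) :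
    ddbar (fun x => u x + v x) z = ddbar u z + ddbar v z := by
  have hu' := analyticAt_ofReal_comp hu
  have hv' := analyticAt_ofReal_comp hv
  rw [ddbar, ddbar, ddbar,
    ← wirtinger_add hu'.wirtingerBar.differentiableAt hv'.wirtingerBar.differentiableAt]
  refine wirtinger_congr ?_
  filter_upwards [hu'.eventually_analyticAt, hv'.eventually_analyticAt] with x hx hy
  rw [← wirtingerBar_add hx.differentiableAt hy.differentiableAt]
  simp only [Complex.ofReal_add]

theorem ddbar_neg (u : ℂ → ℝ) (z : ℂ) : ddbar (fun x => -u x) z = -ddbar u z := by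
  simp only [ddbar, Complex.ofReal_neg]
  rw [← wirtinger_neg]
  congr 1
  funext x
  exact wirtingerBar_neg _ x

theorem ddbar_const (c : ℝ) (z : ℂ) : ddbar (fun _ => c) z = 0 := by
  have : wirtingerBar (fun _ : ℂ => (c : ℂ)) = fun _ => 0 := by
    funext x
    simp [wirtingerBar]
  simp [ddbar, this, wirtinger]

/-- Real parts of holomorphic functions are annihilated by `∂∂̄`. -/
theorem ddbar_re_eq_zero {g : ℂ → ℂ} {z : ℂ} (hg : AnalyticAt ℂ g z) :
    ddbar (fun x => (g x).re) z = 0 := by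
  have hconj {f : ℂ → ℂ} {x : ℂ} (hf : AnalyticAt ℂ f x) :
      HasFDerivAt (fun y => starRingEnd ℂ (f y))
        ((Complex.conjCLE : ℂ →L[ℝ] ℂ).comp ((fderiv ℂ f x).restrictScalars ℝ)) x :=
    (Complex.conjCLE : ℂ →L[ℝ] ℂ).hasFDerivAt.comp x
      (hf.differentiableAt.hasFDerivAt.restrictScalars ℝ)
  have h2 : starRingEnd ℂ 2 = 2 := Complex.conj_ofNat 2
  -- Since Re g = (g + conj g)/2, its ∂̄ is conj(g')/2, which is antiholomorphic and so is killed by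
  -- ∂.
  have h1 : wirtingerBar (fun x => ((g x).re : ℂ))
      =ᶠ[𝓝 z] fun x => starRingEnd ℂ (deriv g x / 2) := by
    filter_upwards [hg.eventually_analyticAt] with x hx
    have hre : (fun x => ((g x).re : ℂ)) = fun x => (g x + starRingEnd ℂ (g x)) * (1 / 2 : ℂ) := by
      funext y
      rw [Complex.re_eq_add_conj]
      ring
    have hd : HasFDerivAt (fun x => (g x + starRingEnd ℂ (g x)) * (1 / 2 : ℂ)) _ x :=
      ((hx.differentiableAt.hasFDerivAt.restrictScalars ℝ).add (hconj hx)).mul_const (1 / 2 : ℂ)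
    rw [hre, wirtingerBar, hd.fderiv]
    simp [h2]
    linear_combination (deriv g x - starRingEnd ℂ (deriv g x)) / 2 * Complex.I_sq
  rw [ddbar, wirtinger_congr h1, wirtinger, (hconj hg.deriv.div_const).fderiv]
  simp [h2]
  linear_combination (starRingEnd ℂ (deriv (deriv g) z)) / 2 * Complex.I_sq

/-- Locally log |c|² is the real part of 2 log c. Dividing c by its value at z moves that value to
1, where the principal branch is holomorphic. -/
theorem ddbar_log_norm_sq_eq_zero {c : ℂ → ℂ} {z : ℂ} (hc : AnalyticAt ℂ c z) (h0 : c z ≠ 0) :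
    ddbar (fun x => Real.log (‖c x‖ ^ 2)) z = 0 := by
  have hq : AnalyticAt ℂ (fun x => c x / c z) z := hc.div_const
  have hs : c z / c z ∈ Complex.slitPlane := by
    rw [div_self h0]
    exact Complex.one_mem_slitPlane
  have hlog : AnalyticAt ℂ (fun x => 2 * Complex.log (c x / c z) + 2 * Real.log ‖c z‖) z :=
    (analyticAt_const.mul (hq.clog hs)).add analyticAt_const
  rw [← ddbar_re_eq_zero hlog]
  refine ddbar_congr ?_
  filter_upwards [hc.continuousAt.eventually_ne h0] with x hx
  have h1 : ‖c x‖ ≠ 0 := norm_ne_zero_iff.2 hx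
  have h2 : ‖c z‖ ≠ 0 := norm_ne_zero_iff.2 h0
  simp only [Complex.add_re, Complex.mul_re, Complex.re_ofNat, Complex.im_ofNat, zero_mul,
    sub_zero, Complex.log_re, norm_div, Complex.ofReal_re, Complex.ofReal_im, mul_zero]
  rw [Real.log_div h1 h2, Real.log_pow]
  push_cast
  ring

theorem AnalyticAt.log_norm_sq {H : Type*} [NormedAddCommGroup H] [InnerProductSpace ℂ H]
    {γ : ℂ → H} {z : ℂ} (hγ : AnalyticAt ℂ γ z) (h0 : γ z ≠ 0) :
    AnalyticAt ℝ (fun x => Real.log (‖γ x‖ ^ 2)) z := by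
  let _ : InnerProductSpace ℝ H := InnerProductSpace.rclikeToReal ℂ H
  have h1 : AnalyticAt ℝ γ z := hγ.restrictScalars
  have h2 : AnalyticAt ℝ (fun x => ‖γ x‖ ^ 2) z := by
    have h3 : AnalyticAt ℝ (fun x => innerSL ℝ (γ x) (γ x)) z :=
      (isBoundedBilinearMap_inner (𝕜 := ℝ) (E := H)).toContinuousLinearMap.analyticAt_bilinear _
        |>.comp (h1.prod h1)
    simpa using h3
  have h3 : 0 < ‖γ z‖ ^ 2 := by positivity
  exact (analyticAt_log h3).comp (f := fun x => ‖γ x‖ ^ 2) h2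

/-! ### Curvature of a backward shift -/

namespace ShiftWeight

variable {W : ShiftWeight}

/-- The frame chosen in `curvature` is unspecified, but it is a multiple of `eigenvec`. The factor
is w_0 times its constant coefficient, hence holomorphic, and contributes only log |c|². -/
theorem curvature_backwardShift (hW : W.KernelSummable) {z : ℂ}
    (hz : z ∈ Metric.ball (0 : ℂ) 1) :
    curvature W.backwardShift z = -ddbar (fun x => Real.log (‖W.eigenvec x‖ ^ 2)) z := by
  have hball : ∀ᶠ x in 𝓝 z, x ∈ Metric.ball (0 : ℂ) 1 := Metric.isOpen_ball.mem_nhds hz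
  have hex : ∃ γ : ℂ → W.H2, IsEigenFrameAt W.backwardShift z γ :=
    ⟨W.eigenvec, analyticAt_eigenvec hW hz, eigenvec_ne_zero hW hz,
      hball.mono fun x hx => backwardShift_eigenvec hW hx⟩
  rw [curvature, dif_pos hex, neg_inj]
  obtain ⟨han, hne, heig⟩ := hex.choose_spec
  set γ := hex.choose
  set c : ℂ → ℂ := fun x => W.w 0 * W.coeffCLM 0 (γ x)
  have hγ : ∀ᶠ x in 𝓝 z, γ x = c x • W.eigenvec x := by
    filter_upwards [heig, hball] with x hx hxb
    exact eq_smul_eigenvec hW hxb hx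
  have hc : AnalyticAt ℂ c z := analyticAt_const.mul (((W.coeffCLM 0).analyticAt _).comp han)
  have hc0 : c z ≠ 0 := by
    intro h
    apply hne
    rw [hγ.self_of_nhds, h, zero_smul]
  have hcid : AnalyticAt ℝ (fun x => Real.log (‖c x‖ ^ 2)) z := hc.log_norm_sq hc0
  rw [← zero_add (ddbar (fun x => Real.log (‖W.eigenvec x‖ ^ 2)) z),
    ← ddbar_log_norm_sq_eq_zero hc hc0,
    ← ddbar_add hcid ((analyticAt_eigenvec hW hz).log_norm_sq (eigenvec_ne_zero hW hz))]
  refine ddbar_congr ?_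
  filter_upwards [hγ, hball, hc.continuousAt.eventually_ne hc0] with x hx hxb hcx
  have h1 := eigenvec_ne_zero hW hxb
  rw [hx, norm_smul, mul_pow, Real.log_mul (by positivity) (by positivity)]

end ShiftWeight

/-! ### Membership in the Cowen–Douglas class -/

namespace ShiftWeight

/-- The weights decrease at most polynomially along every block. -/
def SlowlyDecreasing (W : ShiftWeight) (n : ℕ) : Prop :=
  ∀ j k : ℕ, W.w j ≤ (1 + k : ℝ) ^ n * W.w (j + k)

variable {W : ShiftWeight} {n : ℕ}

theorem SlowlyDecreasing.summable_shift (h : W.SlowlyDecreasing n) (f : W.H2) (k : ℕ) :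
    Summable fun j => W.w j * ‖PowerSeries.coeff (j + k) f.1‖ ^ 2 := by
  have hf : Summable fun j => W.w j * ‖PowerSeries.coeff j f.1‖ ^ 2 := f.2
  refine Summable.of_nonneg_of_le (fun j => mul_nonneg (W.pos _).le (by positivity)) (fun j => ?_)
    (((summable_nat_add_iff k).2 hf).mul_left ((1 + k : ℝ) ^ n))
  rw [← mul_assoc]
  exact mul_le_mul_of_nonneg_right (h j k) (by positivity)

theorem SlowlyDecreasing.tsum_shift_le (h : W.SlowlyDecreasing n) (f : W.H2) (k : ℕ) :
    ∑' j, W.w j * ‖PowerSeries.coeff (j + k) f.1‖ ^ 2 ≤ (1 + k : ℝ) ^ n * ‖f‖ ^ 2 := by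
  have hf : Summable fun j => W.w j * ‖PowerSeries.coeff j f.1‖ ^ 2 := f.2
  calc ∑' j, W.w j * ‖PowerSeries.coeff (j + k) f.1‖ ^ 2
      ≤ ∑' j, (1 + k : ℝ) ^ n * (W.w (j + k) * ‖PowerSeries.coeff (j + k) f.1‖ ^ 2) := by
        refine (h.summable_shift f k).tsum_le_tsum (fun j => ?_)
          (((summable_nat_add_iff k).2 hf).mul_left _)
        rw [← mul_assoc]
        exact mul_le_mul_of_nonneg_right (h j k) (by positivity)
    _ ≤ (1 + k : ℝ) ^ n * ‖f‖ ^ 2 := by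
        rw [tsum_mul_left, norm_sq_eq, ← hf.sum_add_tsum_nat_add k]
        refine mul_le_mul_of_nonneg_left (le_add_of_nonneg_left ?_) (by positivity)
        exact Finset.sum_nonneg fun j _ => mul_nonneg (W.pos j).le (by positivity)

/-- The left inverse `f ↦ (f - f(0)) / z` of the shift, as a linear map. -/
def leftInvLin (h : W.SlowlyDecreasing n) : W.H2 →ₗ[ℂ] W.H2 where
  toFun f := ⟨PowerSeries.mk fun j => PowerSeries.coeff (j + 1) f.1, by
    change Summable _
    simpa using h.summable_shift f 1⟩
  map_add' f g := W.ext_coeff fun j => by simp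
  map_smul' c f := W.ext_coeff fun j => by simp

theorem norm_leftInvLin_le (h : W.SlowlyDecreasing n) (f : W.H2) :
    ‖leftInvLin h f‖ ≤ √(2 ^ n) * ‖f‖ := by
  refine le_of_sq_le_sq ?_ (by positivity)
  rw [mul_pow, Real.sq_sqrt (by positivity), norm_sq_eq]
  have := h.tsum_shift_le f 1
  norm_num at this
  simpa [leftInvLin] using this

/-- The left inverse `f ↦ (f - f(0)) / z` of the shift. -/
def leftInv (h : W.SlowlyDecreasing n) : W.H2 →L[ℂ] W.H2 :=
  (leftInvLin h).mkContinuous _ (norm_leftInvLin_le h)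

theorem coeff_leftInv (h : W.SlowlyDecreasing n) (f : W.H2) (j : ℕ) :
    PowerSeries.coeff j (leftInv h f).1 = PowerSeries.coeff (j + 1) f.1 :=
  PowerSeries.coeff_mk (R := ℂ) j fun j => PowerSeries.coeff (j + 1) f.1

theorem coeff_leftInv_pow (h : W.SlowlyDecreasing n) (f : W.H2) (j k : ℕ) :
    PowerSeries.coeff j ((leftInv h ^ k) f).1 = PowerSeries.coeff (j + k) f.1 := by
  induction k generalizing f with
  | zero => simp
  | succ k ih => rw [pow_succ, mul_apply_eq_comp, ih, coeff_leftInv, add_assoc]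

theorem norm_leftInv_pow_le (h : W.SlowlyDecreasing n) (k : ℕ) :
    ‖leftInv h ^ k‖ ≤ (1 + k : ℝ) ^ n := by
  refine ContinuousLinearMap.opNorm_le_bound _ (by positivity) fun f => ?_
  refine le_of_sq_le_sq ?_ (by positivity)
  rw [norm_sq_eq]
  simp only [coeff_leftInv_pow]
  refine (h.tsum_shift_le f k).trans ?_
  rw [mul_pow]
  refine mul_le_mul_of_nonneg_right ?_ (by positivity)
  -- The bound on the squared norm is reused for the norm: only polynomial growth in k matters.
  exact le_self_pow₀ (one_le_pow₀ (by linarith [k.cast_nonneg (α := ℝ)])) two_ne_zero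

theorem leftInv_mul_shift (h : W.SlowlyDecreasing n) : leftInv h * W.shift = 1 := by
  ext1 f
  refine W.ext_coeff fun j => ?_
  rw [mul_apply_eq_comp, coeff_leftInv]
  exact PowerSeries.coeff_succ_X_mul j f.1

/-- In the disk, `T - z` is surjective. -/
theorem SlowlyDecreasing.surjective_backwardShift_sub (h : W.SlowlyDecreasing n) {z : ℂ}
    (hz : ‖z‖ < 1) :
    Function.Surjective (W.backwardShift - z • ContinuousLinearMap.id ℂ W.H2) := by
  -- Taking adjoints in L S = 1 gives T A = 1, so (T - z)A = 1 - zA. Some power of zA has norm below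
  -- 1, because ‖A^k‖ grows polynomially. Then (1 - zA) ∑_{i<k} (zA)^i = 1 - (zA)^k is invertible,
  -- which yields a right inverse of T - z.
  set A := ContinuousLinearMap.adjoint (leftInv h)
  have hTA : W.backwardShift * A = 1 := by
    have h1 := congrArg star (leftInv_mul_shift h)
    rwa [star_mul, star_one] at h1
  have hApow (k : ℕ) : ‖A ^ k‖ ≤ (1 + k : ℝ) ^ n := by
    have : A ^ k = star (leftInv h ^ k) := (star_pow _ _).symm
    rw [this, norm_star]
    exact norm_leftInv_pow_le h k
  have hlim : Tendsto (fun k : ℕ => ‖z‖ ^ k * (1 + k : ℝ) ^ n) atTop (𝓝 0) := by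
    by_cases hz0 : ‖z‖ = 0
    · refine tendsto_const_nhds.congr' ?_
      filter_upwards [eventually_ge_atTop 1] with k hk
      rw [hz0, zero_pow (by omega), zero_mul]
    have h1 := (tendsto_add_atTop_iff_nat 1).2
      (tendsto_pow_const_mul_const_pow_of_abs_lt_one n (r := ‖z‖) (by simpa using hz))
    have h2 := h1.mul_const (‖z‖⁻¹)
    rw [zero_mul] at h2
    refine h2.congr fun k => ?_
    rw [pow_succ]
    push_cast
    field_simp
    ring
  obtain ⟨k, hk⟩ := (hlim.eventually_lt_const zero_lt_one).exists
  have hxk : ‖(z • A) ^ k‖ < 1 := by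
    rw [smul_pow, norm_smul, norm_pow]
    exact (mul_le_mul_of_nonneg_left (hApow k) (by positivity)).trans_lt hk
  obtain ⟨u, hu⟩ := isUnit_one_sub_of_norm_lt_one hxk
  have hfac : (W.backwardShift - z • ContinuousLinearMap.id ℂ W.H2) *
      (A * (∑ i ∈ Finset.range k, (z • A) ^ i) * (↑u⁻¹ : W.H2 →L[ℂ] W.H2)) = 1 := by
    have h1 : (W.backwardShift - z • ContinuousLinearMap.id ℂ W.H2) * A = 1 - z • A := by
      rw [sub_mul, hTA, smul_mul_assoc]
      rfl
    rw [← mul_assoc, ← mul_assoc, h1, mul_neg_geom_sum, ← hu, u.mul_inv]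
  intro f
  exact ⟨_, DFunLike.congr_fun hfac f⟩

theorem mem_ker_sub_iff {z : ℂ} {f : W.H2} :
    f ∈ (W.backwardShift - z • ContinuousLinearMap.id ℂ W.H2).ker ↔
      W.backwardShift f = z • f := by
  rw [LinearMap.mem_ker]
  simp [sub_eq_zero]

/-- If f is orthogonal to all eigenvectors, the power series ∑ ⟨f, X^j⟩ z^j / w_j vanishes near 0,
so every coefficient of f vanishes. -/
theorem span_ker_dense (hW : W.KernelSummable) :
    (⨆ z ∈ Metric.ball (0 : ℂ) 1,
      (W.backwardShift - z • ContinuousLinearMap.id ℂ W.H2).ker).topologicalClosure = ⊤ := by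
  rw [Submodule.topologicalClosure_eq_top_iff, Submodule.eq_bot_iff]
  intro f hf
  have horth : ∀ z ∈ Metric.ball (0 : ℂ) 1, ⟪f, W.eigenvec z⟫_ℂ = 0 := by
    intro z hz
    refine Submodule.inner_left_of_mem_orthogonal ?_ hf
    exact Submodule.mem_iSup_of_mem z (Submodule.mem_iSup_of_mem hz
      (mem_ker_sub_iff.2 (backwardShift_eigenvec hW hz)))
  have hps := (innerSL ℂ f).comp_hasFPowerSeriesOnBall hW.hasFPowerSeriesOnBall
  have hzero : ∀ᶠ z in 𝓝 (0 : ℂ), (innerSL ℂ f ∘ W.eigenvec) z = 0 := by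
    filter_upwards [Metric.ball_mem_nhds (0 : ℂ) one_pos] with z hz
    exact horth z hz
  have h0 := hps.hasFPowerSeriesAt.eq_zero_of_eventually hzero
  refine W.ext_coeff fun j => ?_
  have hj : (W.w j : ℂ) ≠ 0 := by exact_mod_cast (W.pos j).ne'
  have h1 := DFunLike.congr_fun (congrFun h0 j) (fun _ => (1 : ℂ))
  have h2 : ⟪W.mono j, f⟫_ℂ = 0 := by
    have h3 : ⟪f, (W.w j : ℂ)⁻¹ • W.mono j⟫_ℂ = 0 := by
      simp only [ContinuousLinearMap.compFormalMultilinearSeries_apply, eigenSeries,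
        ContinuousLinearMap.compContinuousMultilinearMap_coe, Function.comp_apply,
        ContinuousMultilinearMap.mkPiRing_apply, Finset.prod_const_one, one_smul] at h1
      exact h1
    rw [inner_smul_right, mul_eq_zero_iff_left (inv_ne_zero hj)] at h3
    exact inner_eq_zero_symm.1 h3
  rw [inner_mono_left] at h2
  simpa [hj] using h2

theorem isCowenDouglas_backwardShift (hW : W.KernelSummable) (h : W.SlowlyDecreasing n) :
    IsCowenDouglas 1 (Metric.ball (0 : ℂ) 1) W.backwardShift where
  rank_pos := one_pos
  isOpen := Metric.isOpen_ball
  isConnected := Metric.isConnected_ball one_pos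
  subset_spectrum := by
    intro z hz hu
    have hu' := hu
    obtain ⟨u, hu⟩ := hu'
    have h1 : (u : W.H2 →L[ℂ] W.H2) (W.eigenvec z) = 0 := by
      rw [hu, Algebra.algebraMap_eq_smul_one]
      simp [backwardShift_eigenvec hW hz]
    refine eigenvec_ne_zero hW hz ?_
    have h2 := DFunLike.congr_fun u.inv_mul (W.eigenvec z)
    rw [mul_apply_eq_comp, h1, map_zero] at h2
    exact h2.symm
  isClosed_range := by
    intro z hz
    rw [(h.surjective_backwardShift_sub (by simpa using hz)).range_eq]
    exact isClosed_univ
  span_ker := span_ker_dense hW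
  finrank_ker := by
    intro z hz
    rw [finrank_eq_one_iff']
    refine ⟨⟨W.eigenvec z, mem_ker_sub_iff.2 (backwardShift_eigenvec hW hz)⟩, ?_, ?_⟩
    · intro h0
      exact eigenvec_ne_zero hW hz (congrArg Subtype.val h0)
    · rintro ⟨f, hf⟩
      exact ⟨_, Subtype.ext (eq_smul_eigenvec hW hz (mem_ker_sub_iff.1 hf)).symm⟩

end ShiftWeight

/-! ### The bump sequence -/

/-- The triangular bump of height `k` centred at `4 ^ k + k`. -/
def bump (k j : ℕ) : ℕ := k - ((j - (4 ^ k + k)) + ((4 ^ k + k) - j))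

/-- The upper envelope of the bumps. -/
def bumps (j : ℕ) : ℕ := (Finset.range (j + 1)).sup fun k => bump k j

/-- Bumps with k > j vanish at j because 4^k > k, so the finite supremum is the supremum over all k.
-/
theorem bump_le_bumps (k j : ℕ) : bump k j ≤ bumps j := by
  by_cases h : k ∈ Finset.range (j + 1)
  · exact Finset.le_sup (f := fun k => bump k j) h
  · have h1 : k < 4 ^ k := Nat.lt_pow_self (by norm_num)
    have h2 : j < k := by simpa using h
    have : bump k j = 0 := by
      unfold bump
      omega
    omega

/-- Each bump has slopes at most 1 in size, and this passes to the supremum. -/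
theorem bumps_add_le (j i : ℕ) : bumps (j + i) ≤ bumps j + i := by
  refine Finset.sup_le fun k _ => ?_
  have h1 := bump_le_bumps k j
  have h2 : bump k (j + i) ≤ bump k j + i := by
    unfold bump
    omega
  omega

theorem bumps_le_succ (j : ℕ) : bumps j ≤ bumps (j + 1) + 1 := by
  refine Finset.sup_le fun k _ => ?_
  have h1 := bump_le_bumps k (j + 1)
  have h2 : bump k j ≤ bump k (j + 1) + 1 := by
    unfold bump
    omega
  omega

theorem bumps_unbounded (K : ℕ) : ∃ j, K ≤ bumps j :=
  ⟨4 ^ K + K, le_trans (by simp [bump]) (bump_le_bumps K (4 ^ K + K))⟩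

/-- The bump lives on fewer than 2k + 1 indices, all at least 4^k, where the summand is at most
k/4^k. -/
theorem sum_bump_div_le (k N : ℕ) :
    ∑ j ∈ Finset.range N, (bump k j : ℝ) / (j + 1) ≤ 2 * ((k : ℝ) ^ 2 * (1 / 4 : ℝ) ^ k) := by
  have h4 : (0 : ℝ) < 4 ^ k := by positivity
  calc ∑ j ∈ Finset.range N, (bump k j : ℝ) / (j + 1)
      ≤ ∑ j ∈ Finset.range N,
          if j ∈ Finset.Ico (4 ^ k) (4 ^ k + 2 * k) then (k : ℝ) / 4 ^ k else 0 := by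
        refine Finset.sum_le_sum fun j _ => ?_
        split_ifs with h
        · have h1 : (bump k j : ℝ) ≤ k := by exact_mod_cast Nat.sub_le _ _
          have h2 : (4 : ℝ) ^ k ≤ j + 1 := by
            have := (Finset.mem_Ico.1 h).1
            exact_mod_cast this.trans (Nat.le_succ j)
          exact div_le_div₀ k.cast_nonneg h1 h4 h2
        · have : bump k j = 0 := by
            rw [Finset.mem_Ico] at h
            unfold bump
            omega
          simp [this]
    _ = ((Finset.range N ∩ Finset.Ico (4 ^ k) (4 ^ k + 2 * k)).card : ℝ) * (k / 4 ^ k) := by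
        rw [Finset.sum_ite_mem, Finset.sum_const, nsmul_eq_mul]
    _ ≤ (2 * k : ℕ) * ((k : ℝ) / 4 ^ k) := by
        refine mul_le_mul_of_nonneg_right ?_ (by positivity)
        refine Nat.cast_le.2 ((Finset.card_le_card Finset.inter_subset_right).trans ?_)
        simp
    _ = _ := by
        push_cast
        rw [one_div, inv_pow]
        ring

theorem summable_bumps : Summable fun j : ℕ => (bumps j : ℝ) / (j + 1) := by
  have hq : ‖(1 / 4 : ℝ)‖ < 1 := by norm_num
  have hs : Summable fun k : ℕ => 2 * ((k : ℝ) ^ 2 * (1 / 4 : ℝ) ^ k) :=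
    (summable_pow_mul_geometric_of_norm_lt_one 2 hq).mul_left 2
  refine summable_of_sum_range_le (c := ∑' k : ℕ, 2 * ((k : ℝ) ^ 2 * (1 / 4 : ℝ) ^ k))
    (fun j => by positivity) fun N => ?_
  calc ∑ j ∈ Finset.range N, (bumps j : ℝ) / (j + 1)
      ≤ ∑ j ∈ Finset.range N, ∑ k ∈ Finset.range N, (bump k j : ℝ) / (j + 1) := by
        refine Finset.sum_le_sum fun j hj => ?_
        rw [← Finset.sum_div]
        refine div_le_div_of_nonneg_right ?_ (by positivity)
        have h1 : bumps j ≤ ∑ k ∈ Finset.range N, bump k j := by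
          refine Finset.sup_le fun k hk => ?_
          have hkN : k ∈ Finset.range N := by
            rw [Finset.mem_range] at *
            omega
          exact Finset.single_le_sum (f := fun k => bump k j) (fun _ _ => Nat.zero_le _) hkN
        exact_mod_cast h1
    _ = ∑ k ∈ Finset.range N, ∑ j ∈ Finset.range N, (bump k j : ℝ) / (j + 1) :=
        Finset.sum_comm
    _ ≤ ∑ k ∈ Finset.range N, 2 * ((k : ℝ) ^ 2 * (1 / 4 : ℝ) ^ k) :=
        Finset.sum_le_sum fun k _ => sum_bump_div_le k N
    _ ≤ _ := hs.sum_le_tsum _ fun k _ => by positivity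

/-! ### Binomial estimates -/

/-- The ratio of the binomials is the product of (j+i+l)/(j+l) over 1 ≤ l ≤ m, and l = 1 gives the
largest factor. -/
theorem choose_add_le (m j i : ℕ) :
    ((j + i + m).choose m : ℝ) * (j + 1) ^ m ≤ (j + i + 1) ^ m * (j + m).choose m := by
  induction m with
  | zero => simp
  | succ m ih =>
    have h1 (l : ℕ) : ((l + (m + 1)).choose (m + 1) : ℝ) * (m + 1)
        = (l + m + 1) * (l + m).choose m := by
      exact_mod_cast (Nat.add_one_mul_choose_eq (l + m) m).symm
    have h2 := h1 (j + i)
    have h3 := h1 j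
    push_cast at h2
    have hm : (0 : ℝ) < m + 1 := by positivity
    refine le_of_mul_le_mul_right ?_ hm
    calc ((j + i + (m + 1)).choose (m + 1) : ℝ) * (j + 1) ^ (m + 1) * (m + 1)
        = ((j + i + m + 1) * (j + 1)) * ((j + i + m).choose m * (j + 1) ^ m) := by
          linear_combination (j + 1 : ℝ) ^ (m + 1) * h2
      _ ≤ ((j + m + 1) * (j + i + 1)) * ((j + i + 1) ^ m * (j + m).choose m) := by
          refine mul_le_mul ?_ ih (by positivity) (by positivity)
          have : (0 : ℝ) ≤ m * i := by positivity
          nlinarith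
      _ = _ := by linear_combination -(j + i + 1 : ℝ) ^ (m + 1) * h3

theorem choose_add_le_pow_mul {m j i : ℕ} {c : ℝ} (hc : (j + i + 1 : ℝ) ≤ c * (j + 1)) :
    ((j + i + m).choose m : ℝ) ≤ c ^ m * (j + m).choose m := by
  have hj : (0 : ℝ) < (j + 1) ^ m := by positivity
  refine le_of_mul_le_mul_right ((choose_add_le m j i).trans ?_) hj
  rw [mul_right_comm, ← mul_pow]
  gcongr

theorem choose_le_choose_add (m j i : ℕ) :
    ((j + m).choose m : ℝ) ≤ ((j + i + m).choose m : ℝ) := by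
  exact_mod_cast Nat.choose_le_choose m (by omega)

theorem hasSum_choose_mul_pow (m : ℕ) {r : ℝ} (h0 : 0 ≤ r) (h1 : r < 1) :
    HasSum (fun j : ℕ => ((j + m).choose m : ℝ) * r ^ j) (1 / (1 - r) ^ (m + 1)) :=
  hasSum_choose_mul_geometric_of_norm_lt_one m (by rwa [Real.norm_of_nonneg h0])

/-- With r = s², each of the j + 1 terms of ∑ C(i+m, m) s^i with j ≤ i ≤ 2j is at least C(j+m, m)
r^j. The full sum is (1-s)^(-(m+1)), and 1 - s ≥ (1-s²)/2 accounts for the power of 2. -/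
theorem choose_mul_pow_le (m j : ℕ) {r : ℝ} (h0 : 0 ≤ r) (h1 : r < 1) :
    ((j + m).choose m : ℝ) * r ^ j ≤ 2 ^ (m + 1) / (j + 1) * (1 / (1 - r) ^ (m + 1)) := by
  obtain ⟨s, hs0, rfl⟩ : ∃ s : ℝ, 0 ≤ s ∧ r = s ^ 2 := ⟨√r, by positivity, (Real.sq_sqrt h0).symm⟩
  have hs1 : s < 1 := by nlinarith
  have hsum := hasSum_choose_mul_pow m hs0 hs1
  have h2 : (j + 1 : ℝ) * ((j + m).choose m * (s ^ 2) ^ j) ≤ 1 / (1 - s) ^ (m + 1) := by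
    calc (j + 1 : ℝ) * ((j + m).choose m * (s ^ 2) ^ j)
        = ∑ i ∈ Finset.range (j + 1), ((j + m).choose m * s ^ (2 * j) : ℝ) := by
          rw [Finset.sum_const, Finset.card_range, nsmul_eq_mul, pow_mul]
          push_cast
          rfl
      _ ≤ ∑ i ∈ Finset.range (j + 1), ((j + i + m).choose m * s ^ (j + i) : ℝ) := by
          refine Finset.sum_le_sum fun i hi => ?_
          refine mul_le_mul (choose_le_choose_add m j i) ?_ (by positivity) (by positivity)
          refine pow_le_pow_of_le_one hs0 hs1.le ?_
          rw [Finset.mem_range] at hi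
          omega
      _ = ∑ i ∈ Finset.Ico j (j + (j + 1)), ((i + m).choose m * s ^ i : ℝ) := by
          rw [Finset.sum_Ico_eq_sum_range]
          simp
      _ ≤ 1 / (1 - s) ^ (m + 1) := by
          refine sum_le_hasSum _ (fun i _ => by positivity) hsum
  have h3 : 1 / (1 - s) ^ (m + 1) ≤ 2 ^ (m + 1) * (1 / (1 - s ^ 2) ^ (m + 1)) := by
    have hs2 : 0 < 1 - s := by linarith
    have hs3 : 0 < 1 - s ^ 2 := by linarith
    rw [mul_one_div, ← div_pow, ← one_div_pow]
    refine pow_le_pow_left₀ (by positivity) ?_ _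
    rw [div_le_div_iff₀ hs2 hs3]
    nlinarith
  have hj : (0 : ℝ) < j + 1 := by positivity
  rw [div_mul_eq_mul_div, le_div_iff₀ hj, mul_comm]
  exact h2.trans h3

/-! ### The perturbed Bergman weights -/

namespace ShiftWeight

theorem bergman_w_succ (m : ℕ) (hm : 1 ≤ m + 1) (j : ℕ) :
    (bergman (m + 1) hm).w j = 1 / ((j + m).choose m : ℝ) := by
  have h : m + 1 + j - 1 = j + m := by omega
  change 1 / ((m + 1 + j - 1).choose j : ℝ) = _
  rw [h, Nat.choose_symm_add]

/-- The weights of `M_{m+1}`, divided by `1 + bumps j`. -/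
def bumpedBergman (m : ℕ) : ShiftWeight where
  w j := 1 / ((j + m).choose m * (1 + bumps j : ℝ))
  pos j := by
    have : 0 < (j + m).choose m := Nat.choose_pos (by omega)
    positivity
  bdd := by
    -- Binomials increase with j, and 1 + b_j ≤ 2 + b_(j+1) ≤ 2(1 + b_(j+1)).
    refine ⟨2, ?_⟩
    rintro _ ⟨j, rfl⟩
    have h0 : 0 < (j + m).choose m := Nat.choose_pos (by omega)
    have h1 : 0 < (j + 1 + m).choose m := Nat.choose_pos (by omega)
    have h2 := choose_le_choose_add m j 1
    have h3 : (bumps j : ℝ) ≤ bumps (j + 1) + 1 := by exact_mod_cast bumps_le_succ j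
    change 1 / ((j + 1 + m).choose m * (1 + bumps (j + 1) : ℝ))
      / (1 / ((j + m).choose m * (1 + bumps j : ℝ))) ≤ 2
    rw [div_div_div_cancel_left' _ _ one_ne_zero, div_le_iff₀ (by positivity),
      mul_left_comm]
    refine mul_le_mul h2 ?_ (by positivity) (by positivity)
    linarith [(bumps (j + 1)).cast_nonneg (α := ℝ)]

theorem bumpedBergman_w (m j : ℕ) :
    (bumpedBergman m).w j = 1 / ((j + m).choose m * (1 + bumps j : ℝ)) := rfl

/-- The binomials contribute (1+k)^m, and 1 + b_j + k ≤ (1+k)(1 + b_j) contributes one more factor.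
-/
theorem slowlyDecreasing_bumpedBergman (m : ℕ) :
    (bumpedBergman m).SlowlyDecreasing (m + 1) := by
  intro j k
  have h0 : 0 < (j + m).choose m := Nat.choose_pos (by omega)
  have h1 : 0 < (j + k + m).choose m := Nat.choose_pos (by omega)
  have hk : (0 : ℝ) ≤ k := k.cast_nonneg
  have hj : (0 : ℝ) ≤ j := j.cast_nonneg
  have h2 : ((j + k + m).choose m : ℝ) ≤ (1 + k) ^ m * (j + m).choose m :=
    choose_add_le_pow_mul (by nlinarith)
  have h3 : (bumps (j + k) : ℝ) ≤ bumps j + k := by exact_mod_cast bumps_add_le j k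
  have hb : (0 : ℝ) ≤ bumps j := (bumps j).cast_nonneg
  rw [bumpedBergman_w, bumpedBergman_w, mul_one_div, div_le_div_iff₀ (by positivity)
    (by positivity), one_mul]
  calc ((j + k + m).choose m : ℝ) * (1 + bumps (j + k))
      ≤ ((1 + k) ^ m * (j + m).choose m) * ((1 + k) * (1 + bumps j)) := by
        refine mul_le_mul h2 ?_ (by positivity) (by positivity)
        nlinarith
    _ = _ := by ring

theorem hasSum_bergman (m : ℕ) (hm : 1 ≤ m + 1) {r : ℝ} (h0 : 0 ≤ r) (h1 : r < 1) :
    HasSum (fun j => r ^ j / (bergman (m + 1) hm).w j) (1 / (1 - r) ^ (m + 1)) := by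
  refine (hasSum_choose_mul_pow m h0 h1).congr_fun ?_
  intro j
  rw [bergman_w_succ, div_div_eq_mul_div, div_one, mul_comm]

theorem kernelSummable_bergman (m : ℕ) (hm : 1 ≤ m + 1) :
    (bergman (m + 1) hm).KernelSummable :=
  fun _ h0 h1 => (hasSum_bergman m hm h0 h1).summable

theorem pow_div_bumpedBergman (m j : ℕ) (r : ℝ) :
    r ^ j / (bumpedBergman m).w j
      = (j + m).choose m * r ^ j + bumps j * ((j + m).choose m * r ^ j) := by
  rw [bumpedBergman_w, div_div_eq_mul_div, div_one]
  ring

/-- The dependence on r is exactly the kernel of M_(m+1), and the remaining factor is summable in j: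
this makes the two kernels comparable. -/
theorem bumps_mul_le (m j : ℕ) {r : ℝ} (h0 : 0 ≤ r) (h1 : r < 1) :
    bumps j * ((j + m).choose m * r ^ j)
      ≤ 2 ^ (m + 1) * (1 / (1 - r) ^ (m + 1)) * ((bumps j : ℝ) / (j + 1)) := by
  refine (mul_le_mul_of_nonneg_left (choose_mul_pow_le m j h0 h1) (by positivity)).trans_eq ?_
  ring

theorem summable_bumps_mul (m : ℕ) {r : ℝ} (h0 : 0 ≤ r) (h1 : r < 1) :
    Summable fun j : ℕ => bumps j * ((j + m).choose m * r ^ j) :=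
  Summable.of_nonneg_of_le (fun j => by positivity) (fun j => bumps_mul_le m j h0 h1)
    (summable_bumps.mul_left _)

theorem kernelSummable_bumpedBergman (m : ℕ) : (bumpedBergman m).KernelSummable := by
  intro r h0 h1
  simp only [pow_div_bumpedBergman]
  exact (hasSum_choose_mul_pow m h0 h1).summable.add (summable_bumps_mul m h0 h1)

theorem le_tsum_bumpedBergman (m : ℕ) {r : ℝ} (h0 : 0 ≤ r) (h1 : r < 1) :
    1 / (1 - r) ^ (m + 1) ≤ ∑' j, r ^ j / (bumpedBergman m).w j := by
  simp only [pow_div_bumpedBergman]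
  rw [(hasSum_choose_mul_pow m h0 h1).summable.tsum_add (summable_bumps_mul m h0 h1),
    (hasSum_choose_mul_pow m h0 h1).tsum_eq]
  exact le_add_of_nonneg_right (tsum_nonneg fun j => by positivity)

theorem tsum_bumpedBergman_le (m : ℕ) {r : ℝ} (h0 : 0 ≤ r) (h1 : r < 1) :
    ∑' j, r ^ j / (bumpedBergman m).w j
      ≤ (1 + 2 ^ (m + 1) * ∑' j : ℕ, (bumps j : ℝ) / (j + 1)) * (1 / (1 - r) ^ (m + 1)) := by
  simp only [pow_div_bumpedBergman]
  rw [(hasSum_choose_mul_pow m h0 h1).summable.tsum_add (summable_bumps_mul m h0 h1),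
    (hasSum_choose_mul_pow m h0 h1).tsum_eq]
  have h2 := (summable_bumps_mul m h0 h1).tsum_le_tsum (fun j => bumps_mul_le m j h0 h1)
    (summable_bumps.mul_left _)
  rw [tsum_mul_left] at h2
  linarith

/-- The weights lie between w_0 (1+j)^(-n) and 1; take logarithms and divide by j. -/
theorem SlowlyDecreasing.tendsto_rpow {W : ShiftWeight} {n : ℕ} (h : W.SlowlyDecreasing n)
    (h1 : ∀ j, W.w j ≤ 1) :
    Tendsto (fun j : ℕ => W.w j ^ (1 / (j : ℝ))) atTop (𝓝 1) := by
  have hlog : Tendsto (fun j : ℕ => Real.log (1 + j) / j) atTop (𝓝 0) := by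
    -- The offset -1 turns the denominator 1 + j into j.
    have h2 := (Real.tendsto_pow_log_div_mul_add_atTop 1 (-1) 1 one_ne_zero).comp
      (tendsto_atTop_add_const_left atTop (1 : ℝ) tendsto_natCast_atTop_atTop)
    simpa [Function.comp_def] using h2
  have hlow : Tendsto (fun j : ℕ => Real.log (W.w 0) / j - n * (Real.log (1 + j) / j))
      atTop (𝓝 0) := by
    simpa using (tendsto_const_div_atTop_nhds_zero_nat (Real.log (W.w 0))).sub
      (hlog.const_mul (n : ℝ))
  have hmid : Tendsto (fun j : ℕ => Real.log (W.w j) * (1 / (j : ℝ))) atTop (𝓝 0) := by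
    refine tendsto_of_tendsto_of_tendsto_of_le_of_le hlow tendsto_const_nhds (fun j => ?_)
      (fun j => ?_)
    · have h3 := Real.log_le_log (W.pos 0) (h 0 j)
      rw [zero_add, Real.log_mul (by positivity) (W.pos j).ne', Real.log_pow] at h3
      change Real.log (W.w 0) / j - n * (Real.log (1 + j) / j) ≤ Real.log (W.w j) * (1 / (j : ℝ))
      rw [← mul_div_assoc, ← sub_div, mul_one_div]
      exact div_le_div_of_nonneg_right (by linarith) j.cast_nonneg
    · exact mul_nonpos_of_nonpos_of_nonneg (Real.log_nonpos (W.pos j).le (h1 j)) (by positivity)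
  have := (Real.continuous_exp.tendsto 0).comp hmid
  rw [Real.exp_zero] at this
  exact this.congr fun j => (Real.rpow_def_of_pos (W.pos j) _).symm

theorem bumpedBergman_le_one (m j : ℕ) : (bumpedBergman m).w j ≤ 1 := by
  have h0 : 0 < (j + m).choose m := Nat.choose_pos (by omega)
  have h1 : (1 : ℝ) ≤ (j + m).choose m := by exact_mod_cast h0
  have h2 : (1 : ℝ) ≤ 1 + bumps j := by simp
  rw [bumpedBergman_w, div_le_one (by positivity)]
  nlinarith

theorem not_isHypercontraction_bumpedBergman (m : ℕ) :
    ¬ IsHypercontraction 1 (bumpedBergman m).backwardShift := by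
  intro h
  have hanti : Antitone (bumpedBergman m).w :=
    antitone_nat_of_succ_le (weight_succ_le_of_contraction _ h)
  set S := ∑' j : ℕ, (bumps j : ℝ) / (j + 1)
  have hbound (j : ℕ) : (1 + bumps j : ℝ) ≤ 2 ^ m * (1 + 2 * S) := by
    -- Monotone weights and C(j+i+m, m) ≤ 2^m C(j+m, m) for i ≤ j make D a lower bound for b on [j,
    -- 2j]. The j + 1 terms b_i/(i+1) there are each at least D/(2(j+1)), so D/2 ≤ S.
    set D : ℝ := (1 + bumps j) / 2 ^ m - 1 with hD
    have hle (i : ℕ) (hi : i ≤ j) : D ≤ bumps (j + i) := by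
      have h0 : 0 < (j + m).choose m := Nat.choose_pos (by omega)
      have h0' : (0 : ℝ) < (j + m).choose m := by exact_mod_cast h0
      have h1 : 0 < (j + i + m).choose m := Nat.choose_pos (by omega)
      have hij : (i : ℝ) ≤ j := by exact_mod_cast hi
      have h2 : ((j + i + m).choose m : ℝ) ≤ 2 ^ m * (j + m).choose m :=
        choose_add_le_pow_mul (by linarith)
      have h3 : (bumpedBergman m).w (j + i) ≤ (bumpedBergman m).w j :=
        hanti (Nat.le_add_right j i)
      rw [bumpedBergman_w, bumpedBergman_w,
        one_div_le_one_div (by positivity) (by positivity)] at h3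
      have h4 : (1 + bumps j : ℝ) ≤ 2 ^ m * (1 + bumps (j + i)) := by
        refine le_of_mul_le_mul_left (h3.trans ?_) h0'
        calc ((j + i + m).choose m : ℝ) * (1 + bumps (j + i))
            ≤ (2 ^ m * (j + m).choose m) * (1 + bumps (j + i)) :=
              mul_le_mul_of_nonneg_right h2 (by positivity)
          _ = _ := by ring
      rw [hD, sub_le_iff_le_add, div_le_iff₀ (by positivity)]
      linarith
    have hsum : (j + 1 : ℝ) * (D / (2 * (j + 1))) ≤ S := by
      rcases le_or_gt D 0 with hD0 | hD0
      · have hS : 0 ≤ S := tsum_nonneg fun j => by positivity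
        refine le_trans ?_ hS
        exact mul_nonpos_of_nonneg_of_nonpos (by positivity)
          (div_nonpos_of_nonpos_of_nonneg hD0 (by positivity))
      calc (j + 1 : ℝ) * (D / (2 * (j + 1)))
          = ∑ i ∈ Finset.range (j + 1), D / (2 * (j + 1)) := by
            rw [Finset.sum_const, Finset.card_range, nsmul_eq_mul]
            push_cast
            rfl
        _ ≤ ∑ i ∈ Finset.range (j + 1), (bumps (j + i) : ℝ) / ((j + i : ℕ) + 1) := by
            refine Finset.sum_le_sum fun i hi => ?_
            have hi' : i ≤ j := Nat.lt_succ_iff.1 (Finset.mem_range.1 hi)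
            have hij : (i : ℝ) ≤ j := by exact_mod_cast hi'
            refine div_le_div₀ (by positivity) (hle i hi') (by positivity) ?_
            push_cast
            linarith
        _ = ∑ i ∈ Finset.Ico j (j + (j + 1)), (bumps i : ℝ) / (i + 1) := by
            rw [Finset.sum_Ico_eq_sum_range]
            simp
        _ ≤ S := summable_bumps.sum_le_tsum _ fun i _ => by positivity
    have h5 : (j + 1 : ℝ) * (D / (2 * (j + 1))) = D / 2 := by
      field_simp
    rw [h5, hD] at hsum
    have h6 : (1 + bumps j : ℝ) / 2 ^ m ≤ 1 + 2 * S := by linarith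
    rwa [div_le_iff₀' (by positivity)] at h6
  obtain ⟨K, hK⟩ := exists_nat_gt (2 ^ m * (1 + 2 * S))
  obtain ⟨j, hj⟩ := bumps_unbounded K
  have h7 : (K : ℝ) ≤ bumps j := by exact_mod_cast hj
  linarith [hbound j]

theorem not_areSimilar_bumpedBergman (m : ℕ) (hm : 1 ≤ m + 1) :
    ¬ AreSimilar (bumpedBergman m).backwardShift (bergman (m + 1) hm).backwardShift := by
  rintro ⟨X, hX⟩
  -- The inverse of X is used because the ratio that is unbounded is the Bergman weight over the
  -- perturbed one, namely 1 + b_j.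
  obtain ⟨C, hC⟩ := (bumpedBergman m).exists_weight_le_of_intertwine
    (V := bergman (m + 1) hm) X.symm X.symm.injective fun x => by
      apply X.injective
      simp [hX]
  obtain ⟨K, hK⟩ := exists_nat_gt C
  obtain ⟨j, hj⟩ := bumps_unbounded K
  have h1 := hC j
  have h0 : 0 < (j + m).choose m := Nat.choose_pos (by omega)
  have h0' : (0 : ℝ) < (j + m).choose m := by exact_mod_cast h0
  have h2 : (K : ℝ) ≤ bumps j := by exact_mod_cast hj
  rw [bergman_w_succ, bumpedBergman_w, mul_one_div, div_le_div_iff₀ h0' (by positivity),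
    one_mul, mul_comm C] at h1
  linarith [le_of_mul_le_mul_left h1 h0']

end ShiftWeight

end

/-! ### The corollary -/

theorem corollary1p7 (n : ℕ) (hn : 1 ≤ n) :
    ∃ W : ShiftWeight,
      liminf (fun j : ℕ => W.w j ^ (1 / (j : ℝ))) atTop = 1 ∧
      IsCowenDouglas 1 (Metric.ball (0 : ℂ) 1) W.backwardShift ∧
      ¬ IsHypercontraction n W.backwardShift ∧
      (∃ ψ : ℂ → ℝ,
        AnalyticOnNhd ℝ ψ (Metric.ball (0 : ℂ) 1) ∧
        (∀ z ∈ Metric.ball (0 : ℂ) 1, 0 < ψ z) ∧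
        (∃ C : ℝ, ∀ z ∈ Metric.ball (0 : ℂ) 1, ψ z ≤ C) ∧
        ∀ z ∈ Metric.ball (0 : ℂ) 1,
          ddbar ψ z =
            curvature (ShiftWeight.bergman n hn).backwardShift z
              - curvature W.backwardShift z) ∧
      ¬ AreSimilar W.backwardShift (ShiftWeight.bergman n hn).backwardShift := by
  obtain ⟨m, rfl⟩ : ∃ m, n = m + 1 := ⟨n - 1, by omega⟩
  set W := ShiftWeight.bumpedBergman m
  set V := ShiftWeight.bergman (m + 1) hn
  have hW : W.KernelSummable := ShiftWeight.kernelSummable_bumpedBergman m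
  have hV : V.KernelSummable := ShiftWeight.kernelSummable_bergman m hn
  have hslow := ShiftWeight.slowlyDecreasing_bumpedBergman m
  set C : ℝ := 1 + 2 ^ (m + 1) * ∑' j : ℕ, (bumps j : ℝ) / (j + 1)
  have hCpos : 0 < C := by
    have : 0 ≤ ∑' j : ℕ, (bumps j : ℝ) / (j + 1) := tsum_nonneg fun j => by positivity
    positivity
  have hnorm : ∀ z ∈ Metric.ball (0 : ℂ) 1,
      ‖V.eigenvec z‖ ^ 2 ≤ ‖W.eigenvec z‖ ^ 2 ∧
        ‖W.eigenvec z‖ ^ 2 ≤ C * ‖V.eigenvec z‖ ^ 2 := by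
    intro z hz
    have hz1 : ‖z‖ < 1 := by simpa using hz
    have h0 : 0 ≤ ‖z‖ ^ 2 := by positivity
    have h1 : ‖z‖ ^ 2 < 1 := by nlinarith [norm_nonneg z]
    rw [ShiftWeight.norm_eigenvec_sq hW hz, ShiftWeight.norm_eigenvec_sq hV hz,
      (ShiftWeight.hasSum_bergman m hn h0 h1).tsum_eq]
    exact ⟨ShiftWeight.le_tsum_bumpedBergman m h0 h1, ShiftWeight.tsum_bumpedBergman_le m h0 h1⟩
  have hpos : ∀ z ∈ Metric.ball (0 : ℂ) 1, 0 < ‖V.eigenvec z‖ ^ 2 := fun z hz => by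
    have := ShiftWeight.eigenvec_ne_zero hV hz
    positivity
  have hanW : ∀ z ∈ Metric.ball (0 : ℂ) 1,
      AnalyticAt ℝ (fun x => Real.log (‖W.eigenvec x‖ ^ 2)) z := fun z hz =>
    (ShiftWeight.analyticAt_eigenvec hW hz).log_norm_sq (ShiftWeight.eigenvec_ne_zero hW hz)
  have hanV : ∀ z ∈ Metric.ball (0 : ℂ) 1,
      AnalyticAt ℝ (fun x => -Real.log (‖V.eigenvec x‖ ^ 2)) z := fun z hz =>
    ((ShiftWeight.analyticAt_eigenvec hV hz).log_norm_sq (ShiftWeight.eigenvec_ne_zero hV hz)).neg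
  refine ⟨W, (hslow.tendsto_rpow (ShiftWeight.bumpedBergman_le_one m)).liminf_eq,
    ShiftWeight.isCowenDouglas_backwardShift hW hslow,
    fun h => ShiftWeight.not_isHypercontraction_bumpedBergman m
      fun k h1 h2 => h k h1 (h2.trans hn), ?_,
    ShiftWeight.not_areSimilar_bumpedBergman m hn⟩
  -- The norm ratio lies in [1, C], so its logarithm is only nonnegative; adding 1 makes ψ strictly
  -- positive without changing ∂∂̄ψ.
  refine ⟨fun z => (Real.log (‖W.eigenvec z‖ ^ 2) + -Real.log (‖V.eigenvec z‖ ^ 2)) + 1,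
    fun z hz => ((hanW z hz).add (hanV z hz)).add analyticAt_const, fun z hz => ?_,
    ⟨Real.log C + 1, fun z hz => ?_⟩, fun z hz => ?_⟩
  · have := Real.log_le_log (hpos z hz) (hnorm z hz).1
    linarith
  · have := Real.log_le_log ((hpos z hz).trans_le (hnorm z hz).1) (hnorm z hz).2
    rw [Real.log_mul hCpos.ne' (hpos z hz).ne'] at this
    linarith
  · have hadd : AnalyticAt ℝ
        (fun x => Real.log (‖W.eigenvec x‖ ^ 2) + -Real.log (‖V.eigenvec x‖ ^ 2)) z :=
      (hanW z hz).add (hanV z hz)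
    rw [ddbar_add hadd analyticAt_const,
      ddbar_add (hanW z hz) (hanV z hz), ddbar_const, ddbar_neg,
      ShiftWeight.curvature_backwardShift hV hz, ShiftWeight.curvature_backwardShift hW hz]
    ring
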